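/- For $n\in\mathbb N$ and $p\in(0,1)$ let $G\sim\mathcal G(n,n,p)$ be the random bipartite graph with sides $\{u_1,\dots,u_n\}$ and $\{v_1,\dots,v_n\}$ in which each pair $u_iv_j$ is an edge independently with probability $p$, and let $d_G$ be its shortest path metric on the $2n$ vertices ($d_G=\infty$ for disconnected pairs). For $c>1$ and $x\in\mathbb Z^{2n}$ (coordinates indexed by the vertices) put $\mathrm{diam}_G^{2,c}(x)=1$ if $x\ge 0$ coordinatewise and $\max\{d_G(i,j):x_i,x_j>0\}\ge 2c$; $\mathrm{diam}_G^{2,c}(x)=0$ if $x\ge0$ coordinatewise and this maximum is at most $2$ (the maximum over the empty set being $0$); and $\mathrm{diam}_G^{2,c}(x)=*$ otherwise. Theorem. There are absolute constants $C>0$ and $a\in\mathbb N$, edge probabilities $p(n,c)\in(0,1)$, where $p(n,c)=n^{-1+1/(2\lceil c\rceil-1)}/\log n$ whenever $1<c$ and $\lceil c\rceil\le\frac{\log n}{20\log\log n}$, and a sequence $\varepsilon_n\to0$ such that for every $n\in\mathbb N$ and every real $c>1$ the following holds with probability at least $1-\varepsilon_n$ over $G\sim\mathcal G(n,n,p(n,c))$.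 For every real $K$ there is a probability distribution $\mathcal D=\mathcal D(G)$ on $\mathbb Z^{2n}$, supported on inputs $x$ with $\mathrm{diam}_G^{2,c}(x)\in\{0,1\}$, such that every linear sketch $(T,\mathrm{Dec})$ consisting of an integer matrix $T\in\mathbb Z^{s\times 2n}$ with all entries of absolute value at most $K(2n)^n$ and a function $\mathrm{Dec}:\mathbb Z^s\to\{0,1\}$ with $$\Pr_{x\sim\mathcal D}\bigl[\mathrm{Dec}(Tx)=\mathrm{diam}_G^{2,c}(x)\bigr]\ \ge\ 1-\frac1{100n}$$ has $$s\ \ge\ C\,\frac{n^{1/(2\lceil c\rceil-1)}}{(\log n)^{a}}.$$ -/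

import Mathlib

open scoped ENNReal Topology

noncomputable section

/-- The bipartite graph with left side `u_1, …, u_n` (the vertices `Sum.inl i`) and right side
`v_1, …, v_n` (the vertices `Sum.inr j`), in which `u_i` and `v_j` are joined exactly when
`(i, j) ∈ E`. -/
def bipartiteGraph {n : ℕ} (E : Set (Fin n × Fin n)) : SimpleGraph (Fin n ⊕ Fin n) :=
  SimpleGraph.fromRel fun a b => ∃ i j, (i, j) ∈ E ∧ a = Sum.inl i ∧ b = Sum.inr j

/-- The law of the edge set of the random bipartite graph `𝒢(n, n, p)`: each of the `n ^ 2` pairs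
`(i, j)` belongs to the edge set independently with probability `p`. -/
def randomBipartite (n : ℕ) (p : unitInterval) : MeasureTheory.Measure (Set (Fin n × Fin n)) :=
  ProbabilityTheory.setBernoulli Set.univ p

/-- The shortest path metric of a graph, with the value `∞` on disconnected pairs. -/
def graphDist {V : Type*} (G : SimpleGraph V) (a b : V) : ℝ≥0∞ :=
  (G.edist a b : ℝ≥0∞)

/-- `max {d i j : x_i, x_j > 0}`, the diameter of the set of points of positive frequency. -/
def frequencyDiam {V : Type*} (d : V → V → ℝ≥0∞) (x : V → ℤ) : ℝ≥0∞ :=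
  ⨆ (i : V) (j : V) (_ : 0 < x i ∧ 0 < x j), d i j

open Classical in
/-- The partial function `diam^{r,c} : ℤ^V → {0, 1, *}`, with `some true` for `1`, `some false`
for `0` and `none` for `*`. -/
def diamDecision {V : Type*} (d : V → V → ℝ≥0∞) (r c : ℝ) (x : V → ℤ) : Option Bool :=
  if (∀ i, 0 ≤ x i) ∧ ENNReal.ofReal (c * r) ≤ frequencyDiam d x then some true
  else if (∀ i, 0 ≤ x i) ∧ frequencyDiam d x ≤ ENNReal.ofReal r then some false
  else none

end

/-!
A linear sketch `T` with few rows is turned into a matrix of small rank whose zero pattern contains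
the edge set of the graph, and a random graph has no such matrix.

Put `k = ⌈c⌉` and write `t_v` for the column of `T` at the vertex `v`. The inputs of the hard
distribution have random positive entries from a very long interval on the closed neighbourhood of
some `v_j`, a set of diameter at most `2`; with probability one half a constant `A` is added at a
vertex `u_i` at distance at least `2 k` from `v_j`. If `t_{u_i}` lies in the rational span of the
columns on the closed neighbourhood, then `A t_{u_i}` is an integer combination of them with bounded
coefficients, for an `A` that depends only on `n`, `K` and the number of rows, since only finitely
many matrices obey the bound on the entries. The random entries absorb the combination, and the
sketch cannot see whether `A` was added (`pow_le_card_wrong`). So a sketch of small error has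
`t_{u_i}` outside the span for almost all far pairs (`exists_hardDistribution`). Choosing for each
`j` a generic functional that kills the span gives an `n × n` matrix, of rank at most the number of
rows of `T`, which vanishes on all edges and on few far pairs (`isLowRankZeroPattern_spannedPairs`).

Matrices of rank `s` have at most `(n + 1) ^ (2 n s)` zero patterns
(`card_lowRankZeroPatterns_le`), whereas a fixed set that misses a quarter of all pairs contains the
random edge set with probability at most `exp (- p n ^ 2 / 4)`. A union bound excludes all patterns
when `s` is at most a small multiple of `n p / log n` (`randomBipartite_real_not_avoids_le`). At
least half of the pairs are far because all degrees are `O(n p)` with high probability, so that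
balls of radius `2 k - 1` have at most `O(n p) ^ (2 k - 1) ≤ n / 2` vertices
(`sq_le_card_farPairs_add`).

For `k` outside the range in which `p` is prescribed, `n ^ (1 / (2 k - 1))` is at most a power of
`log n`, only one row has to be forced, and the same argument applies to a graph without edges.
-/

/-! ### Zero patterns of polynomials and of matrices of small rank -/

theorem finrank_restrictDegree_le (K σ : Type*) [Field K] [Fintype σ] (d : ℕ) :
    Module.finrank K (MvPolynomial.restrictDegree σ K d) ≤ (d + 1) ^ Fintype.card σ := by
  classical
  let e : {m : σ →₀ ℕ | ∀ i, m i ≤ d} → σ → Fin (d + 1) :=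
    fun m i => ⟨m.1 i, Nat.lt_succ_of_le (m.2 i)⟩
  have he : Function.Injective e := by
    intro m m' h
    ext i
    exact congrArg Fin.val (congrFun h i)
  have : Fintype {m : σ →₀ ℕ | ∀ i, m i ≤ d} := Fintype.ofInjective e he
  have hb : Module.finrank K (MvPolynomial.restrictDegree σ K d)
      = Fintype.card {m : σ →₀ ℕ | ∀ i, m i ≤ d} :=
    Module.finrank_eq_card_basis (MvPolynomial.basisRestrictSupport K {m : σ →₀ ℕ | ∀ i, m i ≤ d})
  rw [hb]
  simpa using Fintype.card_le_of_injective e he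

/-- The zero-pattern bound of Rónyai, Babai and Ganapathy: if every product of the `f i` has degree
at most `d` in each variable, the `f i` have at most `(d + 1) ^ |σ|` zero patterns. The products
over the complements of the patterns are linearly independent, because the product belonging to `Z`
is nonzero at a witness of `Z'` exactly when `Z' ⊆ Z`. -/
theorem card_zeroPatterns_le {K σ ι : Type*} [Field K] [Fintype σ] [Fintype ι] [DecidableEq ι]
    (f : ι → MvPolynomial σ K) (d : ℕ)
    (hf : ∀ Z : Finset ι, ∏ i ∈ Z, f i ∈ MvPolynomial.restrictDegree σ K d)
    (P : Finset (Finset ι))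
    (hP : ∀ Z ∈ P, ∃ x : σ → K, ∀ i, i ∈ Z ↔ MvPolynomial.eval x (f i) = 0) :
    P.card ≤ (d + 1) ^ Fintype.card σ := by
  classical
  choose! x hx using hP
  let g : P → MvPolynomial.restrictDegree σ K d := fun Z => ⟨∏ i ∈ (Z.1)ᶜ, f i, hf _⟩
  have hg : LinearIndependent K g := by
    rw [Fintype.linearIndependent_iff]
    intro c hc
    by_contra! hne
    obtain ⟨W, hW⟩ := Finset.exists_maximal (s := Finset.univ.filter fun Z : P => c Z ≠ 0)
      (by obtain ⟨Z, hZ⟩ := hne; exact ⟨Z, by simpa using hZ⟩)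
    have hcW : c W ≠ 0 := by simpa using hW.1
    have h0 : ∑ Z : P, c Z * ∏ i ∈ (Z.1)ᶜ, MvPolynomial.eval (x W) (f i) = 0 := by
      have := congrArg (fun q => MvPolynomial.eval (x W.1) (Subtype.val q)) hc
      simpa [g, map_sum, MvPolynomial.smul_eval, map_prod] using this
    rw [Finset.sum_eq_single W] at h0
    · rcases mul_eq_zero.1 h0 with h | h
      · exact hcW h
      · obtain ⟨i, hi, hi0⟩ := Finset.prod_eq_zero_iff.1 h
        exact (Finset.mem_compl.1 hi) ((hx W.1 W.2 i).2 hi0)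
    · intro Z _ hZW
      by_cases hcZ : c Z = 0
      · simp [hcZ]
      have : ¬ W.1 ⊆ Z.1 := fun h => hZW
        (le_antisymm (hW.2 (by simpa using hcZ) h) h)
      obtain ⟨i, hiW, hiZ⟩ := Finset.not_subset.1 this
      rw [Finset.prod_eq_zero (Finset.mem_compl.2 hiZ) ((hx W.1 W.2 i).1 hiW), mul_zero]
    · simp
  calc P.card = Fintype.card P := by simp
    _ ≤ _ := hg.fintype_card_le_finrank
    _ ≤ _ := finrank_restrictDegree_le K σ d

/-- `Z` is the set of zero entries of a rational `n × n` matrix of rank at most `s`, given by a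
factorization of inner dimension `s`. -/
def IsLowRankZeroPattern (n s : ℕ) (Z : Finset (Fin n × Fin n)) : Prop :=
  ∃ X Y : Fin n → Fin s → ℚ, ∀ i j, (i, j) ∈ Z ↔ ∑ r, Y j r * X i r = 0

theorem card_lowRankZeroPatterns_le (n s : ℕ) (P : Finset (Finset (Fin n × Fin n)))
    (hP : ∀ Z ∈ P, IsLowRankZeroPattern n s Z) : P.card ≤ (n + 1) ^ (2 * n * s) := by
  let f : Fin n × Fin n → MvPolynomial ((Fin n × Fin s) ⊕ (Fin n × Fin s)) ℚ :=
    fun q => ∑ r, MvPolynomial.X (Sum.inr (q.2, r)) * MvPolynomial.X (Sum.inl (q.1, r))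
  -- Each variable occurs, linearly, in the entries of a single row or of a single column.
  have hdeg : ∀ (v : (Fin n × Fin s) ⊕ (Fin n × Fin s)),
      ∑ q : Fin n × Fin n, (f q).degreeOf v ≤ n := by
    intro v
    have hq : ∀ q, (f q).degreeOf v ≤
        Sum.elim (fun a => if a.1 = q.1 then 1 else 0) (fun a => if a.1 = q.2 then 1 else 0) v := by
      intro q
      refine (MvPolynomial.degreeOf_sum_le _ _ _).trans (Finset.sup_le fun r _ => ?_)
      refine (MvPolynomial.degreeOf_mul_le _ _ _).trans ?_
      rw [MvPolynomial.degreeOf_X, MvPolynomial.degreeOf_X]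
      rcases v with ⟨a, b⟩ | ⟨a, b⟩ <;> simp only [Sum.elim_inl, Sum.elim_inr, Sum.inl.injEq,
        Sum.inr.injEq, reduceCtorEq, if_false, Prod.mk.injEq] <;> split_ifs <;> simp_all
    refine (Finset.sum_le_sum fun q _ => hq q).trans ?_
    rw [Fintype.sum_prod_type]
    rcases v with ⟨a, b⟩ | ⟨a, b⟩ <;> simp [apply_ite Finset.card]
  have hf : ∀ Z : Finset (Fin n × Fin n), ∏ q ∈ Z, f q ∈ MvPolynomial.restrictDegree _ ℚ n := by
    intro Z
    rw [MvPolynomial.mem_restrictDegree]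
    intro m hm v
    refine MvPolynomial.degreeOf_le_iff.1 ?_ m hm
    refine (MvPolynomial.degreeOf_prod_le _ _ _).trans (le_trans ?_ (hdeg v))
    exact Finset.sum_le_sum_of_subset (Finset.subset_univ Z)
  have := card_zeroPatterns_le f n hf P fun Z hZ => by
    obtain ⟨X, Y, h⟩ := hP Z hZ
    exact ⟨Sum.elim (fun a => X a.1 a.2) (fun a => Y a.1 a.2), fun q => by
      simpa [f] using h q.1 q.2⟩
  refine this.trans (le_of_eq ?_)
  congr 1
  simp
  ring

/-! ### Balls in graphs of bounded degree -/

theorem ncard_edist_le_pow {V : Type*} [Finite V] (G : SimpleGraph V) (Δ : ℕ)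
    (hΔ : ∀ v, (G.neighborSet v).ncard ≤ Δ) (m : ℕ) (u : V) :
    {v | G.edist u v ≤ m}.ncard ≤ (Δ + 1) ^ m := by
  classical
  have := Fintype.ofFinite V
  induction m generalizing u with
  | zero =>
    have : {v | G.edist u v ≤ (0 : ℕ)} = {u} := by
      ext v
      rw [Set.mem_ofPred_eq, Nat.cast_zero, nonpos_iff_eq_zero, SimpleGraph.edist_eq_zero_iff,
        eq_comm]
      rfl
    rw [this, Set.ncard_singleton, pow_zero]
  | succ m ih =>
    have hsub : {v | G.edist u v ≤ (m + 1 : ℕ)} ⊆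
        insert u (⋃ w ∈ (G.neighborSet u).toFinset, {v | G.edist w v ≤ m}) := by
      intro v hv
      obtain ⟨p, hp⟩ := G.exists_walk_of_edist_ne_top
        (ne_top_of_le_ne_top (ENat.natCast_ne_top _) hv)
      cases p with
      | nil => exact Set.mem_insert _ _
      | cons h q =>
        refine Set.mem_insert_of_mem _ (Set.mem_biUnion (Set.mem_toFinset.2 h) ?_)
        refine (G.edist_le q).trans ?_
        have hv' : G.edist u v ≤ (m + 1 : ℕ) := hv
        rw [← hp] at hv'
        have := Nat.cast_le.1 hv'
        rw [SimpleGraph.Walk.length_cons] at this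
        exact Nat.cast_le.2 (by omega)
    calc {v | G.edist u v ≤ (m + 1 : ℕ)}.ncard
        ≤ _ := Set.ncard_le_ncard hsub
      _ ≤ (⋃ w ∈ (G.neighborSet u).toFinset, {v | G.edist w v ≤ m}).ncard + 1 :=
          Set.ncard_insert_le _ _
      _ ≤ (∑ w ∈ (G.neighborSet u).toFinset, {v | G.edist w v ≤ m}.ncard) + 1 := by
          gcongr
          exact Finset.set_ncard_biUnion_le _ _
      _ ≤ (∑ w ∈ (G.neighborSet u).toFinset, (Δ + 1) ^ m) + 1 := by
          gcongr with w hw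
          exact ih w
      _ = (G.neighborSet u).ncard * (Δ + 1) ^ m + 1 := by
          rw [Finset.sum_const, smul_eq_mul, Set.ncard_eq_toFinset_card']
      _ ≤ Δ * (Δ + 1) ^ m + (Δ + 1) ^ m := by
          gcongr
          · exact hΔ u
          · exact Nat.one_le_pow _ _ (Nat.succ_pos _)
      _ = (Δ + 1) ^ (m + 1) := by ring

theorem bipartiteGraph_adj_inl_inr {n : ℕ} (E : Set (Fin n × Fin n)) (i j : Fin n) :
    (bipartiteGraph E).Adj (Sum.inl i) (Sum.inr j) ↔ (i, j) ∈ E := by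
  simp [bipartiteGraph, SimpleGraph.fromRel_adj]

theorem bipartiteGraph_neighborSet_inl {n : ℕ} (E : Set (Fin n × Fin n)) (i : Fin n) :
    (bipartiteGraph E).neighborSet (Sum.inl i) = Sum.inr '' {j | (i, j) ∈ E} := by
  ext v
  rcases v with v | v <;> simp [bipartiteGraph, SimpleGraph.fromRel_adj]

theorem bipartiteGraph_neighborSet_inr {n : ℕ} (E : Set (Fin n × Fin n)) (j : Fin n) :
    (bipartiteGraph E).neighborSet (Sum.inr j) = Sum.inl '' {i | (i, j) ∈ E} := by
  ext v
  rcases v with v | v <;> simp [bipartiteGraph, SimpleGraph.fromRel_adj]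

open Classical in
/-- The pairs `(i, j)` for which `u_i` and `v_j` have distance at least `m`. -/
noncomputable def farPairs {n : ℕ} (E : Set (Fin n × Fin n)) (m : ℕ) : Finset (Fin n × Fin n) :=
  {q | (m : ℕ∞) ≤ (bipartiteGraph E).edist (Sum.inl q.1) (Sum.inr q.2)}

theorem sq_le_card_farPairs_add {n : ℕ} (E : Set (Fin n × Fin n)) (Δ m : ℕ)
    (hrow : ∀ i, {j | (i, j) ∈ E}.ncard ≤ Δ) (hcol : ∀ j, {i | (i, j) ∈ E}.ncard ≤ Δ) :
    n * n ≤ (farPairs E (m + 1)).card + n * (Δ + 1) ^ m := by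
  classical
  have hdeg : ∀ v, ((bipartiteGraph E).neighborSet v).ncard ≤ Δ := by
    rintro (i | j)
    · rw [bipartiteGraph_neighborSet_inl, Set.ncard_image_of_injective _ Sum.inr_injective]
      exact hrow i
    · rw [bipartiteGraph_neighborSet_inr, Set.ncard_image_of_injective _ Sum.inl_injective]
      exact hcol j
  have hcompl : (farPairs E (m + 1))ᶜ.card ≤ n * (Δ + 1) ^ m := by
    have hle : ∀ i, ((farPairs E (m + 1))ᶜ.filter fun q => q.1 = i).card ≤ (Δ + 1) ^ m := by
      intro i
      rw [← Set.ncard_coe_finset]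
      refine le_trans ?_ (ncard_edist_le_pow (bipartiteGraph E) Δ hdeg m (Sum.inl i))
      refine Set.ncard_le_ncard_of_injOn (fun q => Sum.inr q.2) ?_ ?_
      · rintro ⟨i', j⟩ h
        simp only [farPairs, Finset.coe_filter, Finset.mem_compl, Finset.mem_filter,
          Finset.mem_univ, true_and, not_le, Set.mem_ofPred_eq] at h ⊢
        obtain ⟨h, rfl⟩ := h
        exact ENat.lt_natCast_add_one_iff.1 (by exact_mod_cast h)
      · rintro ⟨i', j⟩ h ⟨i'', j'⟩ h' hj
        simp_all
    calc (farPairs E (m + 1))ᶜ.card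
        = ∑ i, ((farPairs E (m + 1))ᶜ.filter fun q => q.1 = i).card :=
          Finset.card_eq_sum_card_fiberwise fun _ _ => Finset.mem_coe.2 (Finset.mem_univ _)
      _ ≤ ∑ _i : Fin n, (Δ + 1) ^ m := Finset.sum_le_sum fun i _ => hle i
      _ = n * (Δ + 1) ^ m := by simp
  have := Finset.card_add_card_compl (farPairs E (m + 1))
  rw [Fintype.card_prod, Fintype.card_fin] at this
  omega

/-! ### Inputs supported on closed neighbourhoods -/

theorem le_frequencyDiam {V : Type*} (d : V → V → ℝ≥0∞) (x : V → ℤ) {i j : V} (hi : 0 < x i)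
    (hj : 0 < x j) : d i j ≤ frequencyDiam d x :=
  le_iSup₂_of_le i j (le_iSup_of_le ⟨hi, hj⟩ le_rfl)

theorem diamDecision_eq_true {V : Type*} (G : SimpleGraph V) {c : ℝ} {m : ℕ} (hm : 2 * c ≤ m)
    {x : V → ℤ} (hx : ∀ v, 0 ≤ x v) {i j : V} (hi : 0 < x i) (hj : 0 < x j)
    (hij : (m : ℕ∞) ≤ G.edist i j) : diamDecision (graphDist G) 2 c x = some true := by
  rw [diamDecision, if_pos]
  refine ⟨hx, le_trans ?_ (le_frequencyDiam _ x hi hj)⟩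
  calc ENNReal.ofReal (c * 2) ≤ ENNReal.ofReal (m : ℝ) := ENNReal.ofReal_le_ofReal (by linarith)
    _ = ((m : ℕ∞) : ℝ≥0∞) := by simp
    _ ≤ graphDist G i j := ENat.toENNReal_le.2 hij

theorem diamDecision_eq_false {V : Type*} (G : SimpleGraph V) {c : ℝ} (hc : 1 < c)
    {x : V → ℤ} (hx : ∀ v, 0 ≤ x v) (h : ∀ i j, 0 < x i → 0 < x j → G.edist i j ≤ 2) :
    diamDecision (graphDist G) 2 c x = some false := by
  have hle : frequencyDiam (graphDist G) x ≤ ENNReal.ofReal 2 := by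
    refine iSup_le fun i => iSup_le fun j => iSup_le fun hij => ?_
    have := ENat.toENNReal_le.2 (h i j hij.1 hij.2)
    simpa [graphDist] using this
  rw [diamDecision, if_neg, if_pos ⟨hx, hle⟩]
  rintro ⟨-, h2⟩
  have := (ENNReal.ofReal_le_ofReal_iff (by norm_num)).1 (h2.trans hle)
  linarith

/-- The vertex `v_j` together with its neighbours. -/
def closedNbhd {n : ℕ} (E : Set (Fin n × Fin n)) (j : Fin n) : Set (Fin n ⊕ Fin n) :=
  {v | (bipartiteGraph E).edist (Sum.inr j) v ≤ 1}

theorem inr_mem_closedNbhd {n : ℕ} (E : Set (Fin n × Fin n)) (j : Fin n) :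
    Sum.inr j ∈ closedNbhd E j := by
  simp [closedNbhd]

theorem inl_mem_closedNbhd {n : ℕ} {E : Set (Fin n × Fin n)} {i j : Fin n} (h : (i, j) ∈ E) :
    Sum.inl i ∈ closedNbhd E j :=
  SimpleGraph.edist_le_one_iff_adj_or_eq.2
    (Or.inl ((bipartiteGraph_adj_inl_inr E i j).2 h).symm)

theorem edist_le_two_of_mem_closedNbhd {n : ℕ} {E : Set (Fin n × Fin n)} {j : Fin n}
    {v w : Fin n ⊕ Fin n} (hv : v ∈ closedNbhd E j) (hw : w ∈ closedNbhd E j) :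
    (bipartiteGraph E).edist v w ≤ 2 := by
  have hv' : (bipartiteGraph E).edist v (Sum.inr j) ≤ 1 := by
    rw [SimpleGraph.edist_comm]
    exact hv
  exact SimpleGraph.edist_triangle.trans ((add_le_add hv' hw).trans (by norm_num))

/-! ### Masking a column by a random combination of other columns -/

/-- The column of the integer matrix `T` at the coordinate `v`, as a rational vector. -/
def ratCol {V : Type*} {s : ℕ} (T : Matrix (Fin s) V ℤ) (v : V) : Fin s → ℚ :=
  fun r => (T r v : ℚ)

theorem exists_int_combination {V : Type*} [Fintype V] {s : ℕ} (T : Matrix (Fin s) V ℤ)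
    (S : Set V) (u : V) (h : ratCol T u ∈ Submodule.span ℚ (ratCol T '' S)) :
    ∃ (a : ℕ) (w : V → ℤ), 0 < a ∧ (∀ v, v ∉ S → w v = 0) ∧
      T.mulVec w = fun r => (a : ℤ) * T r u := by
  classical
  obtain ⟨q, hqS, hq⟩ : ∃ q : V → ℚ, (∀ v, v ∉ S → q v = 0) ∧ ∑ v, q v • ratCol T v = ratCol T u := by
    obtain ⟨l, hl, hlu⟩ := (Finsupp.mem_span_image_iff_linearCombination ℚ).1 h
    refine ⟨l, fun v hv => Finsupp.notMem_support_iff.1 fun hv' => hv (hl hv'), ?_⟩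
    rw [← hlu, Finsupp.linearCombination_apply, Finsupp.sum_fintype _ _ (by simp)]
  obtain ⟨b, hb⟩ := IsLocalization.exist_integer_multiples_of_finite (nonZeroDivisors ℤ) q
  have hb0 : (b : ℤ) ≠ 0 := nonZeroDivisors.coe_ne_zero b
  choose z hz using hb
  have hz' : ∀ v, (z v : ℚ) = (b : ℤ) * q v := fun v => by simpa using hz v
  refine ⟨((b : ℤ) * b).natAbs, fun v => b * z v, by positivity, fun v hv => ?_, ?_⟩
  · have : (z v : ℚ) = 0 := by rw [hz', hqS v hv, mul_zero]
    simp [Int.cast_eq_zero.1 this]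
  · funext r
    have hr : ∑ v, q v * (T r v : ℚ) = T r u := by
      simpa [ratCol] using congrFun hq r
    have : (((b : ℤ) * b).natAbs : ℤ) = b * b := by
      rw [Int.natCast_natAbs, abs_mul_self]
    rw [this]
    have hQ : ((T.mulVec (fun v => (b : ℤ) * z v) r : ℤ) : ℚ) = ((b : ℤ) * b * T r u : ℤ) := by
      simp only [Matrix.mulVec, dotProduct]
      push_cast
      rw [← hr, Finset.mul_sum]
      refine Finset.sum_congr rfl fun v _ => ?_
      rw [hz']
      ring
    exact_mod_cast hQ

/-- A common multiplier `A` and a common bound `B` for finitely many integer matrices. -/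
theorem exists_uniform_int_combination {V : Type*} [Fintype V] {s : ℕ}
    {M : Set (Matrix (Fin s) V ℤ)} (hM : M.Finite) :
    ∃ A B : ℕ, 0 < A ∧ ∀ T ∈ M, ∀ (S : Set V) (u : V),
      ratCol T u ∈ Submodule.span ℚ (ratCol T '' S) →
      ∃ w : V → ℤ, (∀ v, v ∉ S → w v = 0) ∧ (∀ v, |w v| ≤ B) ∧
        T.mulVec w = fun r => (A : ℤ) * T r u := by
  classical
  have := hM.fintype
  let I := {t : M × Set V × V // ratCol t.1.1 t.2.2 ∈ Submodule.span ℚ (ratCol t.1.1 '' t.2.1)}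
  have : Fintype I := Fintype.ofFinite I
  choose a w ha hw hT using fun t : I => exists_int_combination t.1.1.1 t.1.2.1 t.1.2.2 t.2
  let b : I → ℕ := fun t => ∏ t' ∈ Finset.univ.erase t, a t'
  refine ⟨∏ t, a t, ∑ t : I, ∑ v, ((b t : ℤ) * w t v).natAbs,
    Finset.prod_pos fun t _ => ha t, fun T hTM S u h => ?_⟩
  let t : I := ⟨(⟨T, hTM⟩, S, u), h⟩
  refine ⟨(b t : ℤ) • w t, fun v hv => ?_, fun v => ?_, ?_⟩
  · rw [Pi.smul_apply, hw t v hv, smul_zero]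
  · rw [Pi.smul_apply, smul_eq_mul, Int.abs_eq_natAbs]
    refine Nat.cast_le.2 (le_trans ?_ (Finset.single_le_sum (fun _ _ => Nat.zero_le _)
      (Finset.mem_univ t)))
    exact Finset.single_le_sum (f := fun v => ((b t : ℤ) * w t v).natAbs)
      (fun _ _ => Nat.zero_le _) (Finset.mem_univ v)
  · rw [Matrix.mulVec_smul, hT t]
    funext r
    rw [Pi.smul_apply, smul_eq_mul, ← mul_assoc, ← Finset.mul_prod_erase _ a (Finset.mem_univ t)]
    change (b t : ℤ) * a t * T r u = ((a t * b t : ℕ) : ℤ) * T r u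
    rw [Nat.cast_mul, mul_comm (b t : ℤ)]

/-! ### The hard distribution and the zero pattern of a correct sketch -/

open Classical in
/-- The input with random positive entries `y + 1` on the closed neighbourhood of `v_j` and, if
`b` is true, the entry at `u_i` increased by `A`. -/
noncomputable def hardInput {n L : ℕ} (E : Set (Fin n × Fin n)) (A : ℕ) (q : Fin n × Fin n)
    (b : Bool) (y : Fin n ⊕ Fin n → Fin L) : Fin n ⊕ Fin n → ℤ :=
  fun v => (if v ∈ closedNbhd E q.2 then ((y v : ℕ) : ℤ) + 1 else 0) +
    if b = true ∧ v = Sum.inl q.1 then (A : ℤ) else 0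

theorem diamDecision_hardInput {n L m : ℕ} {E : Set (Fin n × Fin n)} {A : ℕ} (hA : 0 < A) {c : ℝ}
    (hc : 1 < c) (hm : 2 * c ≤ m) {q : Fin n × Fin n} (hq : q ∈ farPairs E m) (b : Bool)
    (y : Fin n ⊕ Fin n → Fin L) :
    diamDecision (graphDist (bipartiteGraph E)) 2 c (hardInput E A q b y) = some b := by
  have h0 : ∀ v, 0 ≤ hardInput E A q b y v := by
    intro v
    unfold hardInput
    split_ifs <;> positivity
  cases b with
  | true =>
    refine diamDecision_eq_true (bipartiteGraph E) hm h0 (i := Sum.inl q.1) (j := Sum.inr q.2)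
      ?_ ?_ (by simpa [farPairs] using hq)
    · unfold hardInput
      rw [if_pos (⟨rfl, rfl⟩ : true = true ∧ (Sum.inl q.1 : Fin n ⊕ Fin n) = Sum.inl q.1)]
      split_ifs <;> positivity
    · unfold hardInput
      rw [if_pos (inr_mem_closedNbhd E q.2)]
      split_ifs <;> positivity
  | false =>
    have hmem : ∀ v, 0 < hardInput E A q false y v → v ∈ closedNbhd E q.2 := by
      intro v hv
      by_contra h
      simp [hardInput, h] at hv
    exact diamDecision_eq_false (bipartiteGraph E) hc h0 fun v w hv hw =>
      edist_le_two_of_mem_closedNbhd (hmem v hv) (hmem w hw)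

/-- If the column at `u_i` is, after multiplication by `A`, an integer combination with coefficients
at most `B` of the columns on the closed neighbourhood of `v_j`, then `T` does not tell the inputs
with `b = false` from those with `b = true`, except near the boundary of the box of the `y`. -/
theorem pow_le_card_wrong {n s L A B : ℕ} (E : Set (Fin n × Fin n)) (q : Fin n × Fin n)
    (T : Matrix (Fin s) (Fin n ⊕ Fin n) ℤ) (Dec : (Fin s → ℤ) → Bool)
    (w : Fin n ⊕ Fin n → ℤ) (hwS : ∀ v, v ∉ closedNbhd E q.2 → w v = 0) (hwB : ∀ v, |w v| ≤ B)
    (hw : T.mulVec w = fun r => (A : ℤ) * T r (Sum.inl q.1)) :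
    (L - 2 * B) ^ (2 * n) ≤ (Finset.univ.filter fun z : Bool × (Fin n ⊕ Fin n → Fin L) =>
      Dec (T.mulVec (hardInput E A q z.1 z.2)) ≠ z.1).card := by
  classical
  by_cases hL : L ≤ 2 * B
  · rcases Nat.eq_zero_or_pos (2 * n) with h | h
    · have hn : n = 0 := by omega
      subst hn
      exact q.1.elim0
    · rw [Nat.sub_eq_zero_of_le hL, zero_pow h.ne']
      exact Nat.zero_le _
  rw [not_le] at hL
  have hwB' : ∀ v, -(B : ℤ) ≤ w v ∧ w v ≤ B := fun v => abs_le.1 (hwB v)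
  -- `lo` and `hi` are points of the box with `hi = lo - w`.
  let lo : (Fin n ⊕ Fin n → Fin (L - 2 * B)) → Fin n ⊕ Fin n → Fin L :=
    fun y v => ⟨y v + B, by have := (y v).2; omega⟩
  let hi : (Fin n ⊕ Fin n → Fin (L - 2 * B)) → Fin n ⊕ Fin n → Fin L :=
    fun y v => ⟨((y v : ℕ) + B - w v : ℤ).toNat, by
      have := (y v).2; have := hwB' v; omega⟩
  have hcoe : ∀ y v, ((hi y v : ℕ) : ℤ) = (y v : ℕ) + B - w v := fun y v => by
    have := hwB' v
    simp only [hi]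
    omega
  have hT : ∀ y, T.mulVec (hardInput E A q true (hi y)) =
      T.mulVec (hardInput E A q false (lo y)) := by
    intro y
    have : hardInput E A q true (hi y) =
        hardInput E A q false (lo y) - w + Pi.single (Sum.inl q.1) (A : ℤ) := by
      funext v
      by_cases hv : v ∈ closedNbhd E q.2
      · simp only [hardInput, hv, if_true, hcoe, lo, true_and, Pi.add_apply, Pi.sub_apply,
          Pi.single_apply, Bool.false_eq_true, false_and, if_false]
        push_cast
        ring
      · simp [hardInput, hv, hwS v hv, Pi.single_apply]
    rw [this, Matrix.mulVec_add, Matrix.mulVec_sub, hw, Matrix.mulVec_single]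
    funext r
    simp [mul_comm]
  let φ : (Fin n ⊕ Fin n → Fin (L - 2 * B)) → Bool × (Fin n ⊕ Fin n → Fin L) := fun y =>
    if Dec (T.mulVec (hardInput E A q false (lo y))) = true then (false, lo y) else (true, hi y)
  have hφ : ∀ y, Dec (T.mulVec (hardInput E A q (φ y).1 (φ y).2)) ≠ (φ y).1 := by
    intro y
    simp only [φ]
    split_ifs with h
    · simp [h]
    · simp [hT y, h]
  have hinj : Function.Injective φ := by
    intro y y' h
    simp only [φ] at h
    split_ifs at h with h1 h2 h2
    · funext v
      have := congrArg Fin.val (congrFun (Prod.ext_iff.1 h).2 v)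
      simp only [lo] at this
      exact Fin.ext (by omega)
    · simp at h
    · simp at h
    · funext v
      have := congrArg Fin.val (congrFun (Prod.ext_iff.1 h).2 v)
      have h3 := hcoe y v
      have h4 := hcoe y' v
      simp only at this
      exact Fin.ext (by omega)
  calc (L - 2 * B) ^ (2 * n) = (Finset.univ.image φ).card := by
        rw [Finset.card_image_of_injective _ hinj]
        simp [two_mul]
    _ ≤ _ := Finset.card_le_card fun z hz => by
        obtain ⟨y, -, rfl⟩ := Finset.mem_image.1 hz
        simpa using hφ y

/-- A box so long that its boundary layer of width `B` holds at most half of its points. -/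
theorem exists_pow_le_two_mul (B N : ℕ) : ∃ L : ℕ, 0 < L ∧ L ^ N ≤ 2 * (L - 2 * B) ^ N := by
  refine ⟨4 * B * N + 2 * B + 1, by omega, ?_⟩
  set L : ℕ := 4 * B * N + 2 * B + 1 with hL
  have hLpos : (0 : ℝ) < L := by rw [hL]; positivity
  have hsub : ((L - 2 * B : ℕ) : ℝ) = L - 2 * B := by
    rw [Nat.cast_sub (by omega)]
    push_cast
    ring
  have hfrac : 2 * B / L * (2 * N) ≤ (1 : ℝ) := by
    rw [div_mul_eq_mul_div, div_le_one hLpos, hL]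
    push_cast
    nlinarith [(Nat.cast_nonneg B : (0 : ℝ) ≤ B)]
  have hone : (2 * B / L : ℝ) ≤ 1 := by
    rw [div_le_one hLpos, hL]
    push_cast
    have : (0 : ℝ) ≤ 4 * B * N := by positivity
    linarith
  have hb := one_add_mul_le_pow (a := -(2 * B / L : ℝ)) (by linarith) N
  have hkey : (L : ℝ) ^ N ≤ 2 * ((L - 2 * B : ℕ) : ℝ) ^ N := by
    have : ((L - 2 * B : ℕ) : ℝ) = L * (1 + -(2 * B / L)) := by
      rw [hsub]
      field_simp
      ring
    rw [this, mul_pow]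
    have h1 : (1 : ℝ) ≤ 2 * (1 + -(2 * B / L)) ^ N := by nlinarith
    nlinarith [pow_pos hLpos N]
  exact_mod_cast hkey

open Classical in
/-- The pairs `(i, j)` for which the column of `T` at `u_i` is spanned by its columns on the closed
neighbourhood of `v_j`. -/
noncomputable def spannedPairs {n s : ℕ} (E : Set (Fin n × Fin n))
    (T : Matrix (Fin s) (Fin n ⊕ Fin n) ℤ) : Finset (Fin n × Fin n) :=
  {q | ratCol T (Sum.inl q.1) ∈ Submodule.span ℚ (ratCol T '' closedNbhd E q.2)}

/-- A single distribution which forces every sketch with bounded entries and small error to have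
few spanned far pairs. A uniform far pair, a uniform bit and a uniform point of the box give the
hard input; on a spanned pair the sketch errs with probability at least `1 / 4`. -/
theorem exists_hardDistribution {n m : ℕ} (s : ℕ) (E : Set (Fin n × Fin n)) {c : ℝ} (hc : 1 < c)
    (hm : 2 * c ≤ m) (hne : (farPairs E m).Nonempty) (R : ℝ) :
    ∃ D : PMF (Fin n ⊕ Fin n → ℤ),
      (∀ x ∈ D.support, diamDecision (graphDist (bipartiteGraph E)) 2 c x ≠ none) ∧
      ∀ (T : Matrix (Fin s) (Fin n ⊕ Fin n) ℤ) (Dec : (Fin s → ℤ) → Bool),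
        (∀ i j, |(T i j : ℝ)| ≤ R) →
        99 / 100 ≤ D.toMeasure.real {x | some (Dec (T.mulVec x)) =
          diamDecision (graphDist (bipartiteGraph E)) 2 c x} →
        25 * (farPairs E m ∩ spannedPairs E T).card ≤ (farPairs E m).card := by
  classical
  -- Only finitely many matrices respect the bound, so `A` and `B` serve all of them.
  have hfin : {T : Matrix (Fin s) (Fin n ⊕ Fin n) ℤ | ∀ i j, |(T i j : ℝ)| ≤ R}.Finite := by
    have : {T : Fin s → Fin n ⊕ Fin n → ℤ | ∀ i j, |(T i j : ℝ)| ≤ R} ⊆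
        Set.Icc (fun _ _ => -⌈R⌉) (fun _ _ => ⌈R⌉) := by
      intro T hT
      refine ⟨fun i j => ?_, fun i j => ?_⟩ <;>
      · have h1 := abs_le.1 (hT i j)
        have h2 := Int.le_ceil R
        have h3 : (-(⌈R⌉ : ℝ)) ≤ T i j ∧ (T i j : ℝ) ≤ ⌈R⌉ := by constructor <;> linarith
        first | exact_mod_cast h3.1 | exact_mod_cast h3.2
    exact (Set.finite_Icc (fun _ _ => -⌈R⌉ : Fin s → Fin n ⊕ Fin n → ℤ) _).subset this
  obtain ⟨A, B, hA, hAB⟩ := exists_uniform_int_combination hfin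
  obtain ⟨L, hL0, hL⟩ := exists_pow_le_two_mul B (2 * n)
  have : Nonempty (Fin L) := ⟨⟨0, hL0⟩⟩
  have : Nonempty (farPairs E m) := hne.to_subtype
  let Ω := farPairs E m × Bool × (Fin n ⊕ Fin n → Fin L)
  let X : Ω → Fin n ⊕ Fin n → ℤ := fun ω => hardInput E A ω.1.1 ω.2.1 ω.2.2
  have hX : ∀ ω : Ω, diamDecision (graphDist (bipartiteGraph E)) 2 c (X ω) = some ω.2.1 :=
    fun ω => diamDecision_hardInput hA hc hm ω.1.2 _ _
  refine ⟨(PMF.uniformOfFintype Ω).map X, ?_, ?_⟩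
  · intro x hx
    obtain ⟨ω, -, rfl⟩ := (PMF.mem_support_map_iff _ _ _).1 hx
    rw [hX]
    exact Option.some_ne_none _
  intro T Dec hT hsucc
  set good : Finset Ω := Finset.univ.filter fun ω => Dec (T.mulVec (X ω)) = ω.2.1 with hgood
  set bad : Finset Ω := Finset.univ.filter fun ω => Dec (T.mulVec (X ω)) ≠ ω.2.1 with hbad
  have hprob : ((PMF.uniformOfFintype Ω).map X).toMeasure.real {x | some (Dec (T.mulVec x)) =
      diamDecision (graphDist (bipartiteGraph E)) 2 c x} = good.card / Fintype.card Ω := by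
    rw [MeasureTheory.measureReal_def, PMF.toMeasure_apply_eq_toOuterMeasure,
      PMF.toOuterMeasure_map_apply, PMF.toOuterMeasure_uniformOfFintype_apply,
      Fintype.card_subtype]
    have : (Finset.univ.filter fun ω : Ω => ω ∈ X ⁻¹' {x | some (Dec (T.mulVec x)) =
        diamDecision (graphDist (bipartiteGraph E)) 2 c x}) = good := by
      ext ω
      simp only [hgood, Finset.mem_filter, Finset.mem_univ, true_and, Set.mem_preimage,
        Set.mem_ofPred_eq, hX, Option.some.injEq]
    rw [this]
    simp
  rw [hprob] at hsucc
  have hcardΩ : Fintype.card Ω = (farPairs E m).card * (2 * L ^ (2 * n)) := by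
    simp [Ω, two_mul]
  have hsplit : good.card + bad.card = Fintype.card Ω := by
    rw [hgood, hbad, Finset.card_filter_add_card_filter_not, Finset.card_univ]
  have hbadle : (farPairs E m ∩ spannedPairs E T).card * L ^ (2 * n) ≤ 2 * bad.card := by
    have h1 : (farPairs E m ∩ spannedPairs E T).card * (L - 2 * B) ^ (2 * n) ≤ bad.card := by
      rw [← smul_eq_mul, ← Finset.sum_const]
      calc ∑ _q ∈ farPairs E m ∩ spannedPairs E T, (L - 2 * B) ^ (2 * n)
          ≤ ∑ q ∈ farPairs E m ∩ spannedPairs E T, (bad.filter fun ω => ω.1.1 = q).card := by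
            refine Finset.sum_le_sum fun q hq => ?_
            obtain ⟨hqf, hqs⟩ := Finset.mem_inter.1 hq
            obtain ⟨w, hw1, hw2, hw3⟩ := hAB T hT (closedNbhd E q.2) (Sum.inl q.1)
              (by simpa [spannedPairs] using hqs)
            refine (pow_le_card_wrong E q T Dec w hw1 hw2 hw3).trans ?_
            refine Finset.card_le_card_of_injOn (fun z => (⟨q, hqf⟩, z)) ?_ ?_
            · intro z hz
              simpa [hbad, X] using hz
            · intro z _ z' _ h
              exact (Prod.ext_iff.1 h).2
        _ = (bad.filter fun ω => ω.1.1 ∈ farPairs E m ∩ spannedPairs E T).card := by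
            rw [Finset.card_eq_sum_card_fiberwise (f := fun ω : Ω => ω.1.1)
              (t := farPairs E m ∩ spannedPairs E T)
              (fun ω hω => by simpa using (Finset.mem_filter.1 hω).2)]
            refine Finset.sum_congr rfl fun q hq => ?_
            congr 1
            ext ω
            simp only [Finset.mem_filter]
            constructor
            · rintro ⟨h, rfl⟩
              exact ⟨⟨h, hq⟩, rfl⟩
            · rintro ⟨⟨h, -⟩, h'⟩
              exact ⟨h, h'⟩
        _ ≤ bad.card := Finset.card_filter_le _ _
    calc _ ≤ (farPairs E m ∩ spannedPairs E T).card * (2 * (L - 2 * B) ^ (2 * n)) := by gcongr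
      _ = 2 * ((farPairs E m ∩ spannedPairs E T).card * (L - 2 * B) ^ (2 * n)) := by ring
      _ ≤ _ := by gcongr
  have hΩpos : (0 : ℝ) < Fintype.card Ω := by exact_mod_cast Fintype.card_pos
  rw [le_div_iff₀ hΩpos] at hsucc
  have hsplit' : (good.card : ℝ) + bad.card = Fintype.card Ω := by exact_mod_cast hsplit
  have hbadle' : ((farPairs E m ∩ spannedPairs E T).card : ℝ) * (L : ℝ) ^ (2 * n)
      ≤ 2 * bad.card := by exact_mod_cast hbadle
  have hcardΩ' : (Fintype.card Ω : ℝ) = (farPairs E m).card * (2 * (L : ℝ) ^ (2 * n)) := by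
    exact_mod_cast hcardΩ
  have hLpos : (0 : ℝ) < (L : ℝ) ^ (2 * n) := by positivity
  have : (25 * (farPairs E m ∩ spannedPairs E T).card : ℝ) * (L : ℝ) ^ (2 * n)
      ≤ (farPairs E m).card * (L : ℝ) ^ (2 * n) := by linarith
  exact_mod_cast le_of_mul_le_mul_right this hLpos

/-- The spanned pairs are the zeros of the matrix of values of generic functionals: for each `j`
one that kills the columns on the closed neighbourhood of `v_j` and no column outside their span. -/
theorem isLowRankZeroPattern_spannedPairs {n s : ℕ} (E : Set (Fin n × Fin n))
    (T : Matrix (Fin s) (Fin n ⊕ Fin n) ℤ) : IsLowRankZeroPattern n s (spannedPairs E T) := by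
  classical
  have hex : ∀ j : Fin n, ∃ φ ∈
      (Submodule.span ℚ (ratCol T '' closedNbhd E j)).dualAnnihilator,
      ∀ i : {i : Fin n // ratCol T (Sum.inl i) ∉ Submodule.span ℚ (ratCol T '' closedNbhd E j)},
        Module.Dual.eval ℚ _ (ratCol T (Sum.inl i.1)) φ ≠ 0 := by
    intro j
    refine Module.Dual.exists_forall_mem_ne_zero_of_forall_exists _ _ fun i => ?_
    obtain ⟨f, hf, hf0⟩ := Submodule.exists_dual_map_eq_bot_of_notMem i.2 inferInstance
    refine ⟨f, ?_, hf⟩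
    rw [Submodule.mem_dualAnnihilator]
    intro x hx
    have : f x ∈ Submodule.map f (Submodule.span ℚ (ratCol T '' closedNbhd E j)) :=
      Submodule.mem_map_of_mem hx
    rw [hf0] at this
    exact (Submodule.mem_bot ℚ).1 this
  choose φ hφ hφ0 using hex
  refine ⟨fun i => ratCol T (Sum.inl i), fun j r => φ j (Pi.single r 1), fun i j => ?_⟩
  have hval : ∑ r, φ j (Pi.single r 1) * ratCol T (Sum.inl i) r = φ j (ratCol T (Sum.inl i)) := by
    conv_rhs => rw [LinearMap.pi_apply_eq_sum_univ (φ j) (ratCol T (Sum.inl i))]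
    refine Finset.sum_congr rfl fun r _ => ?_
    rw [smul_eq_mul, mul_comm]
    congr 2
    funext x
    simp [Pi.single_apply, eq_comm]
  rw [hval]
  simp only [spannedPairs, Finset.mem_filter, Finset.mem_univ, true_and]
  constructor
  · intro h
    exact (Submodule.mem_dualAnnihilator _).1 (hφ j) _ h
  · intro h
    by_contra hn
    exact hφ0 j ⟨i, hn⟩ h

theorem mem_spannedPairs {n s : ℕ} {E : Set (Fin n × Fin n)}
    (T : Matrix (Fin s) (Fin n ⊕ Fin n) ℤ) {q : Fin n × Fin n} (hq : q ∈ E) :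
    q ∈ spannedPairs E T := by
  simp only [spannedPairs, Finset.mem_filter, Finset.mem_univ, true_and]
  exact Submodule.subset_span (Set.mem_image_of_mem _ (inl_mem_closedNbhd hq))

/-- The property of a graph that makes sketches with `s` rows fail: its edge set lies in no zero
pattern of a matrix of rank at most `s` with at least a quarter of the entries nonzero. -/
def AvoidsLowRankZeroPatterns {n : ℕ} (s : ℕ) (E : Set (Fin n × Fin n)) : Prop :=
  ∀ Z : Finset (Fin n × Fin n), IsLowRankZeroPattern n s Z → n * n ≤ 4 * Zᶜ.card →
    ¬ E ⊆ (Z : Set (Fin n × Fin n))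

/-- A sketch with at most `s₀` rows that succeeds on the hard distribution has a zero pattern of rank
at most `s₀` which contains all edges but few far pairs. -/
theorem exists_distribution_forall_lt {n m s₀ : ℕ} (hn : 0 < n) {E : Set (Fin n × Fin n)} {c : ℝ}
    (hc : 1 < c) (hm : 2 * c ≤ m) (hfar : n * n ≤ 2 * (farPairs E m).card)
    (hE : AvoidsLowRankZeroPatterns s₀ E) (K : ℝ) :
    ∃ D : PMF (Fin n ⊕ Fin n → ℤ),
      (∀ x ∈ D.support, diamDecision (graphDist (bipartiteGraph E)) 2 c x ≠ none) ∧
      ∀ (s : ℕ) (T : Matrix (Fin s) (Fin n ⊕ Fin n) ℤ) (Dec : (Fin s → ℤ) → Bool),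
        (∀ i j, |(T i j : ℝ)| ≤ K * (2 * (n : ℝ)) ^ n) →
        1 - 1 / (100 * (n : ℝ)) ≤ D.toMeasure.real {x | some (Dec (T.mulVec x)) =
          diamDecision (graphDist (bipartiteGraph E)) 2 c x} → s₀ < s := by
  classical
  have hne : (farPairs E m).Nonempty := by
    rw [← Finset.card_pos]
    have := Nat.mul_pos hn hn
    omega
  obtain ⟨D, hD, hlow⟩ := exists_hardDistribution s₀ E hc hm hne (max (K * (2 * (n : ℝ)) ^ n) 0)
  refine ⟨D, hD, fun s T Dec hT hsucc => ?_⟩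
  by_contra! hs
  -- Zero rows turn the sketch into one with exactly `s₀` rows.
  let T' : Matrix (Fin s₀) (Fin n ⊕ Fin n) ℤ := fun r v => if h : (r : ℕ) < s then T ⟨r, h⟩ v else 0
  let Dec' : (Fin s₀ → ℤ) → Bool := fun z => Dec fun r => z (Fin.castLE hs r)
  have hDec : ∀ x, Dec' (T'.mulVec x) = Dec (T.mulVec x) := by
    intro x
    simp only [Dec']
    congr 1
    funext r
    simp [T', Matrix.mulVec, dotProduct]
  have hT' : ∀ i j, |(T' i j : ℝ)| ≤ max (K * (2 * (n : ℝ)) ^ n) 0 := by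
    intro i j
    simp only [T']
    split_ifs with h
    · exact (hT _ _).trans (le_max_left _ _)
    · simp
  have hbad := hlow T' Dec' hT' (by
    simp only [hDec]
    refine le_trans ?_ hsucc
    have h1 : (1 : ℝ) ≤ n := by exact_mod_cast hn
    have : 1 / (100 * (n : ℝ)) ≤ 1 / 100 :=
      one_div_le_one_div_of_le (by norm_num) (by linarith)
    linarith)
  refine hE _ (isLowRankZeroPattern_spannedPairs E T') ?_ fun q hq => mem_spannedPairs T' hq
  have h1 : (farPairs E m \ spannedPairs E T').card ≤ (spannedPairs E T')ᶜ.card :=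
    Finset.card_le_card fun q hq => Finset.mem_compl.2 (Finset.mem_sdiff.1 hq).2
  have h2 := Finset.card_sdiff_add_card_inter (farPairs E m) (spannedPairs E T')
  omega

/-! ### Two families of events in the random bipartite graph -/

theorem randomBipartite_real_subset (n : ℕ) (p : unitInterval) (S : Finset (Fin n × Fin n)) :
    (randomBipartite n p).real {E | (S : Set (Fin n × Fin n)) ⊆ E} = (p : ℝ) ^ S.card := by
  have hset : ((fun q : Fin n × Fin n → Prop => {i | q i}) ⁻¹'
      {E | (S : Set (Fin n × Fin n)) ⊆ E}) = (S : Set (Fin n × Fin n)).pi fun _ => {True} := by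
    ext q
    simp [Set.subset_def, Set.mem_pi]
  rw [randomBipartite, MeasureTheory.measureReal_def, ProbabilityTheory.setBernoulli_apply', hset,
    MeasureTheory.Measure.infinitePi_pi _ (fun _ _ => MeasurableSet.of_discrete)]
  simp

theorem randomBipartite_real_disjoint (n : ℕ) (p : unitInterval) (W : Finset (Fin n × Fin n)) :
    (randomBipartite n p).real {E | ∀ q ∈ W, q ∉ E} = (1 - (p : ℝ)) ^ W.card := by
  have hset : ((fun q : Fin n × Fin n → Prop => {i | q i}) ⁻¹' {E | ∀ q ∈ W, q ∉ E}) =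
      (W : Set (Fin n × Fin n)).pi fun _ => {False} := by
    ext q
    simp [Set.mem_pi]
  rw [randomBipartite, MeasureTheory.measureReal_def, ProbabilityTheory.setBernoulli_apply', hset,
    MeasureTheory.Measure.infinitePi_pi _ (fun _ _ => MeasurableSet.of_discrete)]
  simp

instance randomBipartite.instIsProbabilityMeasure (n : ℕ) (p : unitInterval) :
    MeasureTheory.IsProbabilityMeasure (randomBipartite n p) := by
  unfold randomBipartite
  infer_instance

/-- Chernoff-type tail bound, by a union bound over the `t`-subsets of `R`. -/
theorem randomBipartite_real_le_ncard (n : ℕ) (p : unitInterval) (R : Finset (Fin n × Fin n))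
    (hR : R.card = n) (t : ℕ) (ht : 8 * (n * (p : ℝ)) ≤ t) :
    (randomBipartite n p).real {E | t ≤ (E ∩ R).ncard} ≤ Real.exp (-t) := by
  have hp : (0 : ℝ) ≤ p := p.2.1
  have hsub : {E : Set (Fin n × Fin n) | t ≤ (E ∩ R).ncard} ⊆
      ⋃ S ∈ R.powersetCard t, {E | (S : Set (Fin n × Fin n)) ⊆ E} := by
    intro E hE
    obtain ⟨S, hS, hcard⟩ := Set.exists_subset_card_eq hE
    have hfin : S.Finite := S.toFinite
    refine Set.mem_biUnion (x := hfin.toFinset) ?_ ?_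
    · rw [SetLike.mem_coe, Finset.mem_powersetCard]
      refine ⟨fun q hq => (hS (hfin.mem_toFinset.1 hq)).2, ?_⟩
      rw [← hcard, Set.ncard_eq_toFinset_card S hfin]
    · rw [Set.mem_ofPred_eq, hfin.coe_toFinset]
      exact hS.trans Set.inter_subset_left
  have he2 : Real.exp 2 ≤ 8 := by
    have h1 := Real.exp_one_lt_d9
    have h2 : Real.exp 2 = Real.exp 1 * Real.exp 1 := by rw [← Real.exp_add]; norm_num
    rw [h2]
    nlinarith [Real.exp_pos 1]
  calc (randomBipartite n p).real {E | t ≤ (E ∩ R).ncard}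
      ≤ _ := MeasureTheory.measureReal_mono hsub (MeasureTheory.measure_ne_top _ _)
    _ ≤ ∑ S ∈ R.powersetCard t, (randomBipartite n p).real
          {E | (S : Set (Fin n × Fin n)) ⊆ E} := MeasureTheory.measureReal_biUnion_finset_le _ _
    _ = ∑ S ∈ R.powersetCard t, (p : ℝ) ^ t := by
        refine Finset.sum_congr rfl fun S hS => ?_
        rw [randomBipartite_real_subset, (Finset.mem_powersetCard.1 hS).2]
    _ = n.choose t * (p : ℝ) ^ t := by simp [hR]
    _ ≤ (n : ℝ) ^ t / t.factorial * (p : ℝ) ^ t := by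
        gcongr
        exact Nat.choose_le_pow_div t n
    _ = (Real.exp 2 * (n * (p : ℝ))) ^ t / t.factorial * Real.exp (-2 * t) := by
        have : Real.exp (-2 * t) = (Real.exp 2 ^ t)⁻¹ := by
          rw [← Real.exp_nat_mul, ← Real.exp_neg]
          congr 1
          ring
        rw [this, mul_pow, mul_pow]
        field_simp
    _ ≤ Real.exp (Real.exp 2 * (n * (p : ℝ))) * Real.exp (-2 * t) := by
        gcongr
        exact Real.pow_div_factorial_le_exp _ (by positivity) t
    _ ≤ Real.exp (-t) := by
        rw [← Real.exp_add]
        refine Real.exp_le_exp.2 ?_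
        have : Real.exp 2 * (n * (p : ℝ)) ≤ 8 * (n * (p : ℝ)) := by gcongr
        linarith

theorem randomBipartite_real_exists_degree_le (n : ℕ) (p : unitInterval) (t : ℕ)
    (ht : 8 * (n * (p : ℝ)) ≤ t) :
    (randomBipartite n p).real {E | ¬ ((∀ i, {j | (i, j) ∈ E}.ncard ≤ t) ∧
      ∀ j, {i | (i, j) ∈ E}.ncard ≤ t)} ≤ 2 * n * Real.exp (-t) := by
  classical
  let row : Fin n → Finset (Fin n × Fin n) := fun i => Finset.univ.image fun j => (i, j)
  let col : Fin n → Finset (Fin n × Fin n) := fun j => Finset.univ.image fun i => (i, j)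
  have hrow : ∀ i, (row i).card = n := fun i => by
    rw [Finset.card_image_of_injective _ (Prod.mk_right_injective i)]
    simp
  have hcol : ∀ j, (col j).card = n := fun j => by
    rw [Finset.card_image_of_injective _ (Prod.mk_left_injective j)]
    simp
  have hsub : {E : Set (Fin n × Fin n) | ¬ ((∀ i, {j | (i, j) ∈ E}.ncard ≤ t) ∧
      ∀ j, {i | (i, j) ∈ E}.ncard ≤ t)} ⊆
      (⋃ i, {E | t ≤ (E ∩ row i).ncard}) ∪ ⋃ j, {E | t ≤ (E ∩ col j).ncard} := by
    intro E hE
    rw [Set.mem_ofPred_eq, not_and_or, not_forall, not_forall] at hE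
    rcases hE with ⟨i, hi⟩ | ⟨j, hj⟩
    · refine Or.inl (Set.mem_iUnion.2 ⟨i, ?_⟩)
      refine (not_le.1 hi).le.trans ?_
      rw [← Set.ncard_image_of_injective _ (Prod.mk_right_injective i)]
      refine Set.ncard_le_ncard ?_
      rintro _ ⟨j, hj, rfl⟩
      exact ⟨hj, by simp [row]⟩
    · refine Or.inr (Set.mem_iUnion.2 ⟨j, ?_⟩)
      refine (not_le.1 hj).le.trans ?_
      rw [← Set.ncard_image_of_injective _ (Prod.mk_left_injective j)]
      refine Set.ncard_le_ncard ?_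
      rintro _ ⟨i, hi, rfl⟩
      exact ⟨hi, by simp [col]⟩
  calc _ ≤ _ := MeasureTheory.measureReal_mono hsub (MeasureTheory.measure_ne_top _ _)
    _ ≤ _ := MeasureTheory.measureReal_union_le _ _
    _ ≤ (∑ i : Fin n, Real.exp (-t)) + ∑ j : Fin n, Real.exp (-t) := by
        gcongr
        · refine (MeasureTheory.measureReal_iUnion_fintype_le _).trans
            (Finset.sum_le_sum fun i _ => ?_)
          exact randomBipartite_real_le_ncard n p _ (hrow i) t ht
        · refine (MeasureTheory.measureReal_iUnion_fintype_le _).trans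
            (Finset.sum_le_sum fun j _ => ?_)
          exact randomBipartite_real_le_ncard n p _ (hcol j) t ht
    _ = 2 * n * Real.exp (-t) := by
        simp
        ring

theorem randomBipartite_real_not_avoids_le (n s : ℕ) (p : unitInterval) :
    (randomBipartite n p).real {E | ¬ AvoidsLowRankZeroPatterns s E} ≤
      (n + 1 : ℝ) ^ (2 * n * s) * Real.exp (-(p * (n * n) / 4)) := by
  classical
  let P : Finset (Finset (Fin n × Fin n)) :=
    {Z | IsLowRankZeroPattern n s Z ∧ n * n ≤ 4 * Zᶜ.card}
  have hsub : {E : Set (Fin n × Fin n) | ¬ AvoidsLowRankZeroPatterns s E} ⊆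
      ⋃ Z ∈ P, {E | ∀ q ∈ Zᶜ, q ∉ E} := by
    intro E hE
    simp only [Set.mem_ofPred_eq, AvoidsLowRankZeroPatterns] at hE
    push Not at hE
    obtain ⟨Z, h1, h2, h3⟩ := hE
    refine Set.mem_biUnion (x := Z) (by simp [P, h1, h2]) fun q hq hqE => ?_
    exact Finset.mem_compl.1 hq (h3 hqE)
  calc _ ≤ _ := MeasureTheory.measureReal_mono hsub (MeasureTheory.measure_ne_top _ _)
    _ ≤ ∑ Z ∈ P, (randomBipartite n p).real {E | ∀ q ∈ Zᶜ, q ∉ E} :=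
        MeasureTheory.measureReal_biUnion_finset_le _ _
    _ ≤ ∑ Z ∈ P, Real.exp (-(p * (n * n) / 4)) := by
        refine Finset.sum_le_sum fun Z hZ => ?_
        have hZ2 : n * n ≤ 4 * Zᶜ.card := (Finset.mem_filter.1 hZ).2.2
        have hZ3 : (n * n : ℝ) ≤ 4 * Zᶜ.card := by exact_mod_cast hZ2
        rw [randomBipartite_real_disjoint]
        have h1 : (1 - (p : ℝ)) ≤ Real.exp (-p) := by
          have := Real.add_one_le_exp (-(p : ℝ))
          linarith
        calc (1 - (p : ℝ)) ^ Zᶜ.card ≤ Real.exp (-p) ^ Zᶜ.card :=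
              pow_le_pow_left₀ (sub_nonneg.2 p.2.2) h1 _
          _ = Real.exp (-(p * Zᶜ.card)) := by
              rw [← Real.exp_nat_mul]
              congr 1
              ring
          _ ≤ Real.exp (-(p * (n * n) / 4)) := by
              refine Real.exp_le_exp.2 ?_
              have := mul_le_mul_of_nonneg_left hZ3 p.2.1
              linarith
    _ = P.card * Real.exp (-(p * (n * n) / 4)) := by simp
    _ ≤ _ := by
        gcongr
        exact_mod_cast card_lowRankZeroPatterns_le n s P fun Z hZ => (Finset.mem_filter.1 hZ).2.1

/-! ### The choice of the edge probability -/

/-- For the graph with edge set `E` and every bound `K`, one distribution on valid inputs forces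
every sketch of error at most `1 / (100 n)` to have at least `r` rows. -/
def NeedsRows (n : ℕ) (c r : ℝ) (E : Set (Fin n × Fin n)) : Prop :=
  ∀ K : ℝ, ∃ D : PMF (Fin n ⊕ Fin n → ℤ),
    (∀ x ∈ D.support, diamDecision (graphDist (bipartiteGraph E)) 2 c x ≠ none) ∧
    ∀ (s : ℕ) (T : Matrix (Fin s) (Fin n ⊕ Fin n) ℤ) (Dec : (Fin s → ℤ) → Bool),
      (∀ i j, |(T i j : ℝ)| ≤ K * (2 * (n : ℝ)) ^ n) →
      1 - 1 / (100 * (n : ℝ)) ≤ D.toMeasure.real {x | some (Dec (T.mulVec x)) =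
        diamDecision (graphDist (bipartiteGraph E)) 2 c x} → r ≤ (s : ℝ)

theorem needsRows_of_degree_le {n k Δ s₀ : ℕ} (hn : 0 < n) {c r : ℝ} (hc : 1 < c) (hk : c ≤ k)
    (hk1 : 1 ≤ k) {E : Set (Fin n × Fin n)} (hrow : ∀ i, {j | (i, j) ∈ E}.ncard ≤ Δ)
    (hcol : ∀ j, {i | (i, j) ∈ E}.ncard ≤ Δ) (hΔ : 2 * (Δ + 1) ^ (2 * k - 1) ≤ n)
    (hE : AvoidsLowRankZeroPatterns s₀ E) (hr : r ≤ s₀ + 1) : NeedsRows n c r E := by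
  intro K
  have hfar := sq_le_card_farPairs_add E Δ (2 * k - 1) hrow hcol
  have hm : 2 * c ≤ ((2 * k - 1 + 1 : ℕ) : ℝ) := by
    rw [Nat.sub_add_cancel (by omega)]
    push_cast
    linarith
  obtain ⟨D, hD, hlow⟩ := exists_distribution_forall_lt hn hc hm (by
    have := Nat.mul_le_mul_left n hΔ
    nlinarith) hE K
  refine ⟨D, hD, fun s T Dec hT hs => hr.trans ?_⟩
  exact_mod_cast hlow s T Dec hT hs

theorem one_sub_le_randomBipartite_real {n k s₀ Δ : ℕ} (hn : 0 < n) {c r : ℝ} (hc : 1 < c)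
    (hk : c ≤ k) (hk1 : 1 ≤ k) (p : unitInterval) (hΔ : 2 * (Δ + 1) ^ (2 * k - 1) ≤ n)
    (hpΔ : 8 * (n * (p : ℝ)) ≤ Δ) (hr : r ≤ s₀ + 1) :
    1 - (2 * n * Real.exp (-Δ) + (n + 1 : ℝ) ^ (2 * n * s₀) * Real.exp (-(p * (n * n) / 4))) ≤
      (randomBipartite n p).real {E | NeedsRows n c r E} := by
  have hcover : (Set.univ : Set (Set (Fin n × Fin n))) ⊆ {E | NeedsRows n c r E} ∪
      ({E | ¬ ((∀ i, {j | (i, j) ∈ E}.ncard ≤ Δ) ∧ ∀ j, {i | (i, j) ∈ E}.ncard ≤ Δ)} ∪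
        {E | ¬ AvoidsLowRankZeroPatterns s₀ E}) := by
    intro E _
    by_cases h1 : (∀ i, {j | (i, j) ∈ E}.ncard ≤ Δ) ∧ ∀ j, {i | (i, j) ∈ E}.ncard ≤ Δ
    · by_cases h2 : AvoidsLowRankZeroPatterns s₀ E
      · exact Or.inl (needsRows_of_degree_le hn hc hk hk1 h1.1 h1.2 hΔ h2 hr)
      · exact Or.inr (Or.inr h2)
    · exact Or.inr (Or.inl h1)
  have h1 := MeasureTheory.measureReal_mono (μ := randomBipartite n p) hcover
    (MeasureTheory.measure_ne_top _ _)
  rw [MeasureTheory.probReal_univ] at h1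
  have h2 := h1.trans ((MeasureTheory.measureReal_union_le _ _).trans
    (add_le_add_right (MeasureTheory.measureReal_union_le _ _) _))
  have h3 := randomBipartite_real_exists_degree_le n p Δ hpΔ
  have h4 := randomBipartite_real_not_avoids_le n s₀ p
  linarith

/-- The edge probability `n ^ (-1 + 1 / (2 k - 1)) / log n`. The expected degree is then smaller
than `n ^ (1 / (2 k - 1))` by a factor `log n`, which keeps balls of radius `2 k - 1` below `n / 2`
vertices. -/
noncomputable def edgeProb (n k : ℕ) : ℝ := (n : ℝ) ^ (-1 + 1 / (2 * (k : ℝ) - 1)) / Real.log n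

/-- In the prescribed range a random graph has maximum degree `O(n p)` and, for some `s₀` of order
`n p / log n`, avoids the zero patterns of matrices of rank at most `s₀`: there are at most
`exp (n ^ 2 p / 8)` patterns, and each contains the edge set with probability at most
`exp (- n ^ 2 p / 4)`. -/
theorem one_sub_le_of_dense {n k : ℕ} {c : ℝ} (hc : 1 < c) (hk : c ≤ k)
    (hL : 40 ≤ Real.log n) (hcond : (k : ℝ) ≤ Real.log n / (20 * Real.log (Real.log n)))
    (p : unitInterval) (hp : (p : ℝ) = edgeProb n k) :
    1 - 3 / (n : ℝ) ≤ (randomBipartite n p).real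
      {E | NeedsRows n c (1 / 32 * (n : ℝ) ^ (1 / (2 * (k : ℝ) - 1)) / Real.log n ^ 20) E} := by
  set L := Real.log n with hLdef
  have hn : 0 < n := by
    rcases Nat.eq_zero_or_pos n with h | h
    · rw [hLdef, h, Nat.cast_zero, Real.log_zero] at hL
      norm_num at hL
    · exact h
  have hn' : (0 : ℝ) < n := by exact_mod_cast hn
  have hexpL : Real.exp L = n := Real.exp_log hn'
  have hn40 : (40 : ℝ) ≤ n := by
    have := Real.add_one_le_exp L
    linarith
  have hLpos : 0 < L := by linarith
  have hLL : 0 < Real.log L := Real.log_pos (by linarith)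
  have hkc : (1 : ℝ) < k := hc.trans_le hk
  have hk1 : 1 ≤ k := by exact_mod_cast hkc.le
  have hk2 : (1 : ℝ) ≤ 2 * k - 1 := by linarith
  set x : ℝ := (n : ℝ) ^ (1 / (2 * (k : ℝ) - 1)) with hx
  have hx0 : 0 < x := Real.rpow_pos_of_pos hn' _
  have hcast : ((2 * k - 1 : ℕ) : ℝ) = 2 * k - 1 := by
    rw [Nat.cast_sub (by omega)]
    push_cast
    ring
  have hxpow : x ^ (2 * k - 1) = n := by
    rw [hx, ← Real.rpow_natCast, ← Real.rpow_mul hn'.le, hcast, one_div,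
      inv_mul_cancel₀ (by linarith), Real.rpow_one]
  -- The restriction on `k` makes the degree a large power of `log n`.
  have hxL : L ^ 10 ≤ x := by
    have h1 : L ^ 10 = Real.exp (10 * Real.log L) := by
      rw [mul_comm, Real.exp_mul, Real.exp_log hLpos]
      norm_cast
    rw [h1, hx, Real.rpow_def_of_pos hn']
    refine Real.exp_le_exp.2 ?_
    rw [mul_one_div, le_div_iff₀ (by linarith)]
    rw [le_div_iff₀ (by positivity)] at hcond
    nlinarith
  set d : ℝ := x / L with hd
  have hnp : n * (p : ℝ) = d := by
    rw [hp, edgeProb, Real.rpow_add hn', Real.rpow_neg_one, ← hLdef, ← hx, hd]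
    field_simp
  have hdL : L ≤ d := by
    rw [hd, le_div_iff₀ hLpos]
    refine le_trans ?_ hxL
    calc L * L = L ^ 2 := by ring
      _ ≤ L ^ 10 := pow_le_pow_right₀ (by linarith) (by norm_num)
  set Δ : ℕ := ⌈8 * d⌉₊ with hΔ
  have hΔ1 : 8 * d ≤ Δ := Nat.le_ceil _
  have hΔ2 : (Δ : ℝ) ≤ 8 * d + 1 := (Nat.ceil_lt_add_one (by linarith)).le
  have hball : 2 * (Δ + 1) ^ (2 * k - 1) ≤ n := by
    have h1 : (Δ : ℝ) + 1 ≤ 10 / L * x := by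
      have : 10 / L * x = 10 * d := by
        rw [hd]
        ring
      rw [this]
      linarith
    have h2 : 10 / L ≤ 1 / 2 := by
      rw [div_le_iff₀ hLpos]
      linarith
    have h3 : (10 / L) ^ (2 * k - 1) ≤ 1 / 2 :=
      (pow_le_of_le_one (by positivity) (by linarith) (by omega)).trans h2
    have h4 : 2 * ((Δ : ℝ) + 1) ^ (2 * k - 1) ≤ n := by
      calc 2 * ((Δ : ℝ) + 1) ^ (2 * k - 1) ≤ 2 * (10 / L * x) ^ (2 * k - 1) := by gcongr
        _ = 2 * ((10 / L) ^ (2 * k - 1) * n) := by rw [mul_pow, hxpow]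
        _ ≤ 2 * (1 / 2 * n) := by gcongr
        _ = n := by ring
    exact_mod_cast h4
  set s₀ : ℕ := ⌊d / (32 * L)⌋₊ with hs₀
  have hs1 : (s₀ : ℝ) ≤ d / (32 * L) := Nat.floor_le (by positivity)
  have hs2 : d / (32 * L) ≤ s₀ + 1 := (Nat.lt_floor_add_one _).le
  have hr : 1 / 32 * x / L ^ 20 ≤ s₀ + 1 := by
    refine le_trans ?_ hs2
    have : d / (32 * L) = 1 / 32 * x / L ^ 2 := by
      rw [hd]
      field_simp
    rw [this]
    gcongr
    · linarith
    · norm_num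
  have hmain := one_sub_le_randomBipartite_real hn hc hk hk1 p hball (by rw [hnp]; exact hΔ1) hr
  refine le_trans ?_ hmain
  have he1 : 2 * n * Real.exp (-Δ) ≤ 2 / (n : ℝ) := by
    have h1 : Real.exp (-Δ) ≤ Real.exp (-(2 * L)) := Real.exp_le_exp.2 (by linarith)
    have h2 : Real.exp (-(2 * L)) = 1 / ((n : ℝ) * n) := by
      rw [two_mul, Real.exp_neg, Real.exp_add, hexpL, one_div]
    rw [h2] at h1
    calc 2 * n * Real.exp (-Δ) ≤ 2 * n * (1 / ((n : ℝ) * n)) := by gcongr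
      _ = 2 / (n : ℝ) := by field_simp
  have he2 : (n + 1 : ℝ) ^ (2 * n * s₀) * Real.exp (-(p * (n * n) / 4)) ≤ 1 / (n : ℝ) := by
    have h1 : (n + 1 : ℝ) ≤ Real.exp (2 * L) := by
      rw [two_mul, Real.exp_add, hexpL]
      nlinarith
    have h2 : (s₀ : ℝ) * (32 * L) ≤ d := (le_div_iff₀ (by positivity)).1 hs1
    calc (n + 1 : ℝ) ^ (2 * n * s₀) * Real.exp (-(p * (n * n) / 4))
        ≤ Real.exp (2 * L) ^ (2 * n * s₀) * Real.exp (-(p * (n * n) / 4)) := by gcongr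
      _ = Real.exp (n * (4 * (s₀ * L)) - n * (n * p) / 4) := by
          rw [← Real.exp_nat_mul, ← Real.exp_add]
          congr 1
          push_cast
          ring
      _ ≤ Real.exp (-L) := by
          rw [hnp]
          refine Real.exp_le_exp.2 ?_
          have h3 : (n : ℝ) * (4 * (s₀ * L)) ≤ n * (d / 8) := by
            gcongr
            linarith
          have h4 : 40 * d ≤ n * d := by gcongr
          linarith
      _ = 1 / (n : ℝ) := by rw [Real.exp_neg, hexpL, one_div]
  have : 2 / (n : ℝ) + 1 / n = 3 / n := by ring
  linarith

theorem avoidsLowRankZeroPatterns_zero_empty {n : ℕ} (hn : 0 < n) :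
    AvoidsLowRankZeroPatterns 0 (∅ : Set (Fin n × Fin n)) := by
  rintro Z ⟨X, Y, hXY⟩ hZ
  have : Z = Finset.univ := Finset.eq_univ_of_forall fun q => (hXY q.1 q.2).2 (by simp)
  rw [this] at hZ
  have := Nat.mul_pos hn hn
  simp at hZ
  omega

/-- Outside the prescribed range the bound asks for a single row. For a graph without edges every
pair `(u_i, v_j)` is far, and a sketch without rows fails since the only pattern of rank zero is the
full one. -/
theorem one_sub_le_of_sparse {n k : ℕ} {c : ℝ} (hc : 1 < c) (hk : c ≤ k) (hL : 40 ≤ Real.log n)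
    (hcond : ¬ (k : ℝ) ≤ Real.log n / (20 * Real.log (Real.log n)))
    (p : unitInterval) (hp : (p : ℝ) = 1 / ((n : ℝ) + 2) ^ 3) :
    1 - 3 / (n : ℝ) ≤ (randomBipartite n p).real
      {E | NeedsRows n c (1 / 32 * (n : ℝ) ^ (1 / (2 * (k : ℝ) - 1)) / Real.log n ^ 20) E} := by
  set L := Real.log n with hLdef
  have hn2 : 2 ≤ n := by
    by_contra! h
    interval_cases n <;> norm_num [hLdef] at hL
  have hn' : (0 : ℝ) < n := by positivity
  have hLpos : 0 < L := by linarith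
  have hLL : 0 < Real.log L := Real.log_pos (by linarith)
  have hkc : (1 : ℝ) < k := hc.trans_le hk
  have hk1 : 1 ≤ k := by exact_mod_cast hkc.le
  have hr : 1 / 32 * (n : ℝ) ^ (1 / (2 * (k : ℝ) - 1)) / L ^ 20 ≤ (0 : ℕ) + 1 := by
    have h1 : (n : ℝ) ^ (1 / (2 * (k : ℝ) - 1)) ≤ L ^ 20 := by
      have h1 : L ^ 20 = Real.exp (20 * Real.log L) := by
        rw [mul_comm, Real.exp_mul, Real.exp_log hLpos]
        norm_cast
      rw [h1, Real.rpow_def_of_pos hn']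
      refine Real.exp_le_exp.2 ?_
      rw [mul_one_div, div_le_iff₀ (by linarith)]
      rw [not_le, div_lt_iff₀ (by positivity)] at hcond
      nlinarith
    rw [div_le_iff₀ (by positivity), Nat.cast_zero, zero_add, one_mul]
    have := Real.rpow_pos_of_pos hn' (1 / (2 * (k : ℝ) - 1))
    linarith
  have hsub : {E : Set (Fin n × Fin n) | ∀ q ∈ (Finset.univ : Finset (Fin n × Fin n)), q ∉ E} ⊆
      {E | NeedsRows n c (1 / 32 * (n : ℝ) ^ (1 / (2 * (k : ℝ) - 1)) / L ^ 20) E} := by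
    intro E hE
    have hE0 : E = ∅ := Set.eq_empty_of_forall_notMem fun q => hE q (Finset.mem_univ q)
    subst hE0
    exact needsRows_of_degree_le (Δ := 0) (by omega) hc hk hk1 (by simp) (by simp) (by simpa)
      (avoidsLowRankZeroPatterns_zero_empty (by omega)) hr
  refine le_trans ?_ (MeasureTheory.measureReal_mono hsub (MeasureTheory.measure_ne_top _ _))
  rw [randomBipartite_real_disjoint, hp]
  have hb := one_add_mul_le_pow (a := -(1 / ((n : ℝ) + 2) ^ 3)) (by
    have : 1 / ((n : ℝ) + 2) ^ 3 ≤ 1 := by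
      rw [div_le_one (by positivity)]
      exact one_le_pow₀ (by linarith)
    linarith) (Finset.univ : Finset (Fin n × Fin n)).card
  rw [← sub_eq_add_neg] at hb
  refine le_trans ?_ hb
  have h1 : ((Finset.univ : Finset (Fin n × Fin n)).card : ℝ) = n * n := by simp
  have h2 : (n : ℝ) * n * (1 / ((n : ℝ) + 2) ^ 3) ≤ 3 / n := by
    rw [mul_one_div, div_le_div_iff₀ (by positivity) hn']
    nlinarith [pow_pos hn' 2, pow_pos hn' 3]
  rw [h1]
  linarith

theorem edgeProb_mem_Ioo {n k : ℕ} (hk : 2 ≤ k)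
    (hcond : (k : ℝ) ≤ Real.log n / (20 * Real.log (Real.log n))) :
    edgeProb n k ∈ Set.Ioo (0 : ℝ) 1 := by
  have hk' : (2 : ℝ) ≤ k := by exact_mod_cast hk
  have hpos : 0 < Real.log n / (20 * Real.log (Real.log n)) := by linarith
  have hlog : 0 ≤ Real.log n := Real.log_natCast_nonneg n
  -- Positivity of the quotient forces `log (log n) > 0`.
  have hLL : 0 < Real.log (Real.log n) := by
    by_contra! h
    exact absurd (div_nonpos_of_nonneg_of_nonpos hlog (by linarith)) (not_le.2 hpos)
  have hL : 1 < Real.log n := by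
    by_contra! h
    exact absurd (Real.log_nonpos hlog h) (not_le.2 hLL)
  have hn0 : n ≠ 0 := by
    rintro rfl
    norm_num at hL
  have hn : (1 : ℝ) ≤ n := by exact_mod_cast Nat.one_le_iff_ne_zero.2 hn0
  refine ⟨div_pos (Real.rpow_pos_of_pos (by linarith) _) (by linarith), ?_⟩
  rw [edgeProb, div_lt_one (by linarith)]
  refine lt_of_le_of_lt (Real.rpow_le_one_of_one_le_of_nonpos hn ?_) hL
  have : 1 / (2 * (k : ℝ) - 1) ≤ 1 := by
    rw [div_le_one (by linarith)]
    linarith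
  linarith

theorem mainTheorem3 :
    ∃ (C : ℝ) (a : ℕ) (p : ℕ → ℝ → unitInterval) (ε : ℕ → ℝ),
      0 < C ∧
      (∀ (n : ℕ) (c : ℝ), (p n c : ℝ) ∈ Set.Ioo (0 : ℝ) 1) ∧
      (∀ (n : ℕ) (c : ℝ), 1 < c →
        (⌈c⌉₊ : ℝ) ≤ Real.log n / (20 * Real.log (Real.log n)) →
        (p n c : ℝ) = (n : ℝ) ^ (-1 + 1 / (2 * (⌈c⌉₊ : ℝ) - 1)) / Real.log n) ∧
      Filter.Tendsto ε Filter.atTop (𝓝 0) ∧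
      ∀ (n : ℕ) (c : ℝ), 1 < c →
        1 - ε n ≤ (randomBipartite n (p n c)).real
          {E : Set (Fin n × Fin n) |
            ∀ K : ℝ, ∃ D : PMF (Fin n ⊕ Fin n → ℤ),
              (∀ x ∈ D.support,
                diamDecision (graphDist (bipartiteGraph E)) 2 c x ≠ none) ∧
              ∀ (s : ℕ) (T : Matrix (Fin s) (Fin n ⊕ Fin n) ℤ) (Dec : (Fin s → ℤ) → Bool),
                (∀ i j, |(T i j : ℝ)| ≤ K * (2 * (n : ℝ)) ^ n) →
                1 - 1 / (100 * (n : ℝ)) ≤ D.toMeasure.real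
                  {x | some (Dec (T.mulVec x)) =
                    diamDecision (graphDist (bipartiteGraph E)) 2 c x} →
                C * (n : ℝ) ^ (1 / (2 * (⌈c⌉₊ : ℝ) - 1)) / Real.log n ^ a ≤ (s : ℝ)} := by
  classical
  -- Outside the prescribed range the bound is at most one row, and a graph without edges suffices.
  let q : ℕ → ℝ → ℝ := fun n c =>
    if 1 < c ∧ (⌈c⌉₊ : ℝ) ≤ Real.log n / (20 * Real.log (Real.log n)) then edgeProb n ⌈c⌉₊
    else 1 / ((n : ℝ) + 2) ^ 3
  have hq : ∀ n c, q n c ∈ Set.Ioo (0 : ℝ) 1 := by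
    intro n c
    by_cases h : 1 < c ∧ (⌈c⌉₊ : ℝ) ≤ Real.log n / (20 * Real.log (Real.log n))
    · simp only [q, if_pos h]
      exact edgeProb_mem_Ioo (Nat.lt_ceil.2 (by exact_mod_cast h.1)) h.2
    · simp only [q, if_neg h]
      refine ⟨by positivity, ?_⟩
      rw [div_lt_one (by positivity)]
      exact one_lt_pow₀ (by linarith [(Nat.cast_nonneg n : (0 : ℝ) ≤ n)]) (by norm_num)
  refine ⟨1 / 32, 20, fun n c => ⟨q n c, (hq n c).1.le, (hq n c).2.le⟩,
    fun n => if 40 ≤ Real.log n then 3 / n else 1, by norm_num, hq, ?_, ?_, ?_⟩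
  · intro n c hc hcond
    exact if_pos ⟨hc, hcond⟩
  · have hlarge : ∀ᶠ n : ℕ in Filter.atTop, 40 ≤ Real.log n :=
      (Real.tendsto_log_atTop.comp tendsto_natCast_atTop_atTop).eventually_ge_atTop 40
    refine (tendsto_const_div_atTop_nhds_zero_nat (3 : ℝ)).congr' ?_
    filter_upwards [hlarge] with n hn
    rw [if_pos hn]
  · intro n c hc
    by_cases hL : 40 ≤ Real.log n
    · refine le_trans (le_of_eq (congrArg (1 - ·) (if_pos hL))) ?_
      by_cases hcond : (⌈c⌉₊ : ℝ) ≤ Real.log n / (20 * Real.log (Real.log n))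
      · exact one_sub_le_of_dense hc (Nat.le_ceil c) hL hcond _ (if_pos ⟨hc, hcond⟩)
      · exact one_sub_le_of_sparse hc (Nat.le_ceil c) hL hcond _ (if_neg fun h => hcond h.2)
    · exact le_trans (le_of_eq ((congrArg (1 - ·) (if_neg hL)).trans (sub_self 1)))
        MeasureTheory.measureReal_nonneg
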